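/- Let $n,d,s\ge 1$ be integers and $\sigma>0$. Let $\mathcal P_{s,d}=\{N(\theta,\sigma^2 I_{d\times d}) : \theta\in\mathbb R^d,\ \|\theta\|_0\le s\}$ be the $s$-sparse Gaussian location family, where $\|\theta\|_0$ denotes the number of non-zero entries of $\theta$, and for $P\in\mathcal P_{s,d}$ let $\theta(P)$ denote its mean. Define the minimax risk in squared Euclidean norm by $$\mathfrak M_n\big(\theta(\mathcal P_{s,d}),\|\cdot\|_2^2\big)=\inf_{\hat\theta}\ \sup_{P\in\mathcal P_{s,d}}\mathbb E_P\Big[\big\|\hat\theta(X_1,\dots,X_n)-\theta(P)\big\|_2^2\Big],$$ where $X_1,\dots,X_n$ are i.i.d. with distribution $P$ and the infimum ranges over all measurable functions $\hat\theta:(\mathbb R^d)^n\to\mathbb R^d$. Then there is a universal constant $c>0$, independent of $n,d,s$ and $\sigma$, such that for all such $n,d,s,\sigma$, $$\mathfrak M_n\big(\theta(\mathcal P_{s,d}),\|\cdot\|_2^2\big)\ \ge\ c\,\frac{\sigma^2\, s\,\log(d/s)}{n}.$$ -/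

import Mathlib

open MeasureTheory ProbabilityTheory
open scoped NNReal ENNReal

noncomputable section

/-- The risk `E_P[Φ(ρ(est(X₁,…,Xₙ), θ(P)))]` of an estimator `est`, where `X₁,…,Xₙ` are i.i.d.
with distribution `P` (so that the sample has law `P ⊗ ⋯ ⊗ P`). It takes values in `[0,∞]`. -/
def iidRisk {𝓧 Θ : Type*} [MeasurableSpace 𝓧] (n : ℕ) (θ : Measure 𝓧 → Θ)
    (Φ : ℝ≥0 → ℝ≥0) (ρ : Θ → Θ → ℝ≥0) (est : (Fin n → 𝓧) → Θ) (P : Measure 𝓧) : ℝ≥0∞ :=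
  ∫⁻ x, (Φ (ρ (est x) (θ P)) : ℝ≥0∞) ∂(Measure.pi fun _ : Fin n => P)

/-- The minimax risk, based on `n` i.i.d. observations, for estimating the parameter `θ(P)` over
the family `𝓕`: the infimum over all measurable estimators of the worst-case risk over `𝓕`. -/
def iidMinimaxRisk {𝓧 Θ : Type*} [MeasurableSpace 𝓧] [MeasurableSpace Θ] (n : ℕ)
    (𝓕 : Set (Measure 𝓧)) (θ : Measure 𝓧 → Θ) (Φ : ℝ≥0 → ℝ≥0) (ρ : Θ → Θ → ℝ≥0) : ℝ≥0∞ :=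
  ⨅ (est : (Fin n → 𝓧) → Θ) (_ : Measurable est), ⨆ P ∈ 𝓕, iidRisk n θ Φ ρ est P

/-- The number of non-zero entries of a vector. -/
def l0norm {d : ℕ} (θ : EuclideanSpace ℝ (Fin d)) : ℕ := hammingNorm fun i => θ i

/-- The `s`-sparse Gaussian location family `{N(θ, σ² I) : ‖θ‖₀ ≤ s}` on `ℝᵈ`. -/
def sparseGaussianFamily (s d : ℕ) (σ : ℝ) : Set (Measure (EuclideanSpace ℝ (Fin d))) :=
  {P | ∃ θ : EuclideanSpace ℝ (Fin d), l0norm θ ≤ s ∧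
    P = multivariateGaussian θ (σ ^ 2 • (1 : Matrix (Fin d) (Fin d) ℝ))}

/-- The mean of a distribution on `ℝᵈ`. -/
def meanParam {d : ℕ} (P : Measure (EuclideanSpace ℝ (Fin d))) : EuclideanSpace ℝ (Fin d) :=
  ∫ x, x ∂P

end

/-! The minimax risk dominates the average risk under a product prior. Take `s` disjoint blocks of
`m = ⌊d/s⌋` coordinates; each block independently holds, with probability 1/2, a spike of height `r`
at a uniform position. The squared loss dominates the sum of the block losses, so one block can be
treated at a time with the others frozen.

In a block, the spikes' likelihood ratios have product moments 1 off the diagonal and `exp(n r²/σ²)`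
on it (`lintegral_sampleLikelihoodRatio_mul`). If this is at most `1 + m/2`, the uniform mixture has
χ²-divergence at most 1/2 from no spike, so no estimator does well on both
(`spike_mixture_risk_lower_bound`). Each block then costs at least `r²/32`, and `r² = σ²
log(m+1)/(2n)` is admissible. -/

/-! ### Gaussian likelihood ratios and their product moments. -/

theorem MeasureTheory.Measure.pi_withDensity {ι : Type*} [Fintype ι] {α : ι → Type*}
    [∀ i, MeasurableSpace (α i)] (μ : ∀ i, Measure (α i)) [∀ i, IsProbabilityMeasure (μ i)]
    (f : ∀ i, α i → ℝ≥0∞) (hf : ∀ i, Measurable (f i))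
    [∀ i, SigmaFinite ((μ i).withDensity (f i))] :
    Measure.pi (fun i => (μ i).withDensity (f i)) =
      (Measure.pi μ).withDensity (fun x => ∏ i, f i (x i)) := by
  classical
  refine Measure.pi_eq fun s hs => ?_
  rw [withDensity_apply _ (MeasurableSet.univ_pi hs),
    ← lintegral_indicator (MeasurableSet.univ_pi hs)]
  have h1 : (fun x : ∀ i, α i => (Set.univ.pi s).indicator (fun x => ∏ i, f i (x i)) x) =
      fun x => ∏ i, (s i).indicator (f i) (x i) := by
    ext x
    by_cases hx : x ∈ Set.univ.pi s
    · rw [Set.indicator_of_mem hx]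
      refine Finset.prod_congr rfl fun i _ => ?_
      rw [Set.indicator_of_mem (hx i (Set.mem_univ i))]
    · rw [Set.indicator_of_notMem hx]
      simp only [Set.mem_pi, Set.mem_univ, true_implies, not_forall] at hx
      obtain ⟨i, hi⟩ := hx
      exact (Finset.prod_eq_zero (Finset.mem_univ i) (Set.indicator_of_notMem hi _)).symm
  have hm : ∀ i, Measurable ((s i).indicator (f i)) := fun i => (hf i).indicator (hs i)
  have h2 := lintegral_prod_eq_prod_lintegral_of_indepFun (μ := Measure.pi μ) Finset.univ
    (fun i x => (s i).indicator (f i) (x i))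
    (iIndepFun_pi (fun i => (hm i).aemeasurable))
    (fun i => (hm i).comp (measurable_pi_apply i))
  rw [h1]
  refine Eq.trans (by simpa using h2) (Finset.prod_congr rfl fun i _ => ?_)
  rw [withDensity_apply _ (hs i), ← lintegral_indicator (hs i)]
  exact (measurePreserving_eval μ i).lintegral_comp (hm i)

theorem multivariateGaussian_smul_one_eq_map_pi {d : ℕ} (θ : EuclideanSpace ℝ (Fin d)) (σ : ℝ) :
    multivariateGaussian θ (σ ^ 2 • (1 : Matrix (Fin d) (Fin d) ℝ)) =
      (Measure.pi fun i => gaussianReal (θ i) (σ ^ 2).toNNReal).map (WithLp.toLp 2) := by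
  apply Measure.ext_of_charFun (E := EuclideanSpace ℝ (Fin d))
  ext t
  have hS : (σ ^ 2 • (1 : Matrix (Fin d) (Fin d) ℝ)).PosSemidef :=
    Matrix.PosSemidef.one.smul (sq_nonneg σ)
  simp_rw [charFun_multivariateGaussian hS, charFun_pi, charFun_gaussianReal, ← Complex.exp_sum]
  congr 1
  simp only [Finset.sum_sub_distrib, Matrix.smul_mulVec, Matrix.one_mulVec, PiLp.inner_apply,
    dotProduct, Pi.smul_apply, smul_eq_mul, Real.coe_toNNReal _ (sq_nonneg σ), RCLike.inner_apply,
    conj_trivial]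
  push_cast
  rw [Finset.sum_mul, Finset.sum_div]
  congr 1
  · exact Finset.sum_congr rfl fun i _ => by ring
  · exact Finset.sum_congr rfl fun i _ => by ring

theorem gaussianReal_add_eq_withDensity (θ δ : ℝ) {v : ℝ≥0} (hv : v ≠ 0) :
    gaussianReal (θ + δ) v = (gaussianReal θ v).withDensity
      (fun x => ENNReal.ofReal (Real.exp (δ * (x - θ) / v - δ ^ 2 / (2 * v)))) := by
  rw [gaussianReal_of_var_ne_zero _ hv, gaussianReal_of_var_ne_zero _ hv,
    ← withDensity_mul _ (measurable_gaussianPDF _ _) (by fun_prop)]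
  congr 1
  ext x
  have hv' : (v : ℝ) ≠ 0 := by exact_mod_cast hv
  simp only [Pi.mul_apply, gaussianPDF, gaussianPDFReal]
  rw [← ENNReal.ofReal_mul (by positivity), mul_assoc _ (Real.exp _) (Real.exp _), ← Real.exp_add]
  congr 3
  field_simp
  ring

/-- The density of `N(θ + δ, σ² I)` with respect to `N(θ, σ² I)`. -/
noncomputable def gaussianShiftDensity {d : ℕ} (σ : ℝ) (θ δ x : EuclideanSpace ℝ (Fin d)) :
    ℝ≥0∞ :=
  ENNReal.ofReal (Real.exp (inner ℝ δ (x - θ) / σ ^ 2 - inner ℝ δ δ / (2 * σ ^ 2)))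

theorem measurable_gaussianShiftDensity {d : ℕ} (σ : ℝ) (θ δ : EuclideanSpace ℝ (Fin d)) :
    Measurable (gaussianShiftDensity σ θ δ) := by
  unfold gaussianShiftDensity
  fun_prop

theorem multivariateGaussian_add_eq_withDensity {d : ℕ} (θ δ : EuclideanSpace ℝ (Fin d))
    {σ : ℝ} (hσ : 0 < σ) :
    multivariateGaussian (θ + δ) (σ ^ 2 • (1 : Matrix (Fin d) (Fin d) ℝ)) =
      (multivariateGaussian θ (σ ^ 2 • (1 : Matrix (Fin d) (Fin d) ℝ))).withDensity
        (gaussianShiftDensity σ θ δ) := by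
  have hv : (σ ^ 2).toNNReal ≠ 0 := by
    rw [Ne, Real.toNNReal_eq_zero, not_le]
    positivity
  have key := fun i => gaussianReal_add_eq_withDensity (θ i) (δ i) hv
  have hsf : ∀ i, SigmaFinite ((gaussianReal (θ i) (σ ^ 2).toNNReal).withDensity
      (fun x => ENNReal.ofReal (Real.exp (δ i * (x - θ i) / ((σ ^ 2).toNNReal : ℝ)
        - δ i ^ 2 / (2 * ((σ ^ 2).toNNReal : ℝ)))))) := by
    intro i
    rw [← key i]
    infer_instance
  rw [multivariateGaussian_smul_one_eq_map_pi, multivariateGaussian_smul_one_eq_map_pi]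
  simp only [PiLp.add_apply]
  simp_rw [key]
  rw [Measure.pi_withDensity _ _ (fun i => by fun_prop)]
  ext s hs
  have hm : Measurable (WithLp.toLp 2 : (Fin d → ℝ) → EuclideanSpace ℝ (Fin d)) := by fun_prop
  rw [Measure.map_apply hm hs, withDensity_apply _ (hm hs), withDensity_apply _ hs,
    setLIntegral_map hs (measurable_gaussianShiftDensity σ θ δ) hm]
  congr 1
  ext x
  rw [gaussianShiftDensity, ← ENNReal.ofReal_prod_of_nonneg (fun _ _ => Real.exp_nonneg _),
    ← Real.exp_sum]
  simp only [PiLp.inner_apply, PiLp.sub_apply, RCLike.inner_apply, conj_trivial,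
    Real.coe_toNNReal _ (sq_nonneg σ), Finset.sum_sub_distrib, Finset.sum_div]
  congr 3
  · exact Finset.sum_congr rfl fun i _ => by ring
  · exact Finset.sum_congr rfl fun i _ => by ring

/-- The joint law of `n` independent observations from `N(θ, σ² I)`. -/
noncomputable def gaussianSample {d : ℕ} (n : ℕ) (σ : ℝ) (θ : EuclideanSpace ℝ (Fin d)) :
    Measure (Fin n → EuclideanSpace ℝ (Fin d)) :=
  Measure.pi fun _ => multivariateGaussian θ (σ ^ 2 • (1 : Matrix (Fin d) (Fin d) ℝ))

instance {d : ℕ} (n : ℕ) (σ : ℝ) (θ : EuclideanSpace ℝ (Fin d)) :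
    IsProbabilityMeasure (gaussianSample n σ θ) := by
  unfold gaussianSample
  infer_instance

/-- The likelihood ratio of `n` independent observations for the means `θ + δ` and `θ`. -/
noncomputable def sampleLikelihoodRatio {d n : ℕ} (σ : ℝ) (θ δ : EuclideanSpace ℝ (Fin d))
    (x : Fin n → EuclideanSpace ℝ (Fin d)) : ℝ≥0∞ :=
  ∏ i, gaussianShiftDensity σ θ δ (x i)

theorem measurable_sampleLikelihoodRatio {d n : ℕ} (σ : ℝ) (θ δ : EuclideanSpace ℝ (Fin d)) :
    Measurable (sampleLikelihoodRatio (n := n) σ θ δ) :=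
  Finset.measurable_fun_prod _ fun i _ =>
    (measurable_gaussianShiftDensity σ θ δ).comp (measurable_pi_apply i)

theorem gaussianSample_add {d : ℕ} (n : ℕ) {σ : ℝ} (hσ : 0 < σ)
    (θ δ : EuclideanSpace ℝ (Fin d)) :
    gaussianSample n σ (θ + δ) =
      (gaussianSample n σ θ).withDensity (sampleLikelihoodRatio σ θ δ) := by
  have key := multivariateGaussian_add_eq_withDensity θ δ hσ
  have : SigmaFinite ((multivariateGaussian θ (σ ^ 2 • (1 : Matrix (Fin d) (Fin d) ℝ))).withDensity
      (gaussianShiftDensity σ θ δ)) := by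
    rw [← key]
    infer_instance
  unfold gaussianSample
  simp_rw [key]
  exact Measure.pi_withDensity _ _ fun _ => measurable_gaussianShiftDensity σ θ δ

theorem lintegral_sampleLikelihoodRatio {d : ℕ} (n : ℕ) {σ : ℝ} (hσ : 0 < σ)
    (θ δ : EuclideanSpace ℝ (Fin d)) :
    ∫⁻ x, sampleLikelihoodRatio σ θ δ x ∂(gaussianSample n σ θ) = 1 := by
  have h := congrArg (fun μ => μ Set.univ) (gaussianSample_add n hσ θ δ)
  simpa using h.symm

/-- Completing the square: the exponents add up to that of the shift `δ + δ'`, apart from the cross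
term of `‖δ + δ'‖²`. The remaining ratio integrates to 1, so orthogonal shifts are uncorrelated. -/
theorem sampleLikelihoodRatio_mul {d n : ℕ} {σ : ℝ} (hσ : 0 < σ)
    (θ δ δ' : EuclideanSpace ℝ (Fin d)) (x : Fin n → EuclideanSpace ℝ (Fin d)) :
    sampleLikelihoodRatio σ θ δ x * sampleLikelihoodRatio σ θ δ' x =
      ENNReal.ofReal (Real.exp (n * inner ℝ δ δ' / σ ^ 2)) *
        sampleLikelihoodRatio σ θ (δ + δ') x := by
  have h : ∀ y, gaussianShiftDensity σ θ δ y * gaussianShiftDensity σ θ δ' y =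
      ENNReal.ofReal (Real.exp (inner ℝ δ δ' / σ ^ 2)) * gaussianShiftDensity σ θ (δ + δ') y := by
    intro y
    simp only [gaussianShiftDensity]
    rw [← ENNReal.ofReal_mul (Real.exp_nonneg _), ← ENNReal.ofReal_mul (Real.exp_nonneg _),
      ← Real.exp_add, ← Real.exp_add]
    congr 2
    simp only [inner_add_left, inner_add_right, real_inner_comm δ δ']
    field_simp
    ring
  simp only [sampleLikelihoodRatio]
  rw [← Finset.prod_mul_distrib, Finset.prod_congr rfl fun i _ => h (x i),
    Finset.prod_mul_distrib, Finset.prod_const, Finset.card_univ, Fintype.card_fin,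
    ← ENNReal.ofReal_pow (Real.exp_nonneg _), ← Real.exp_nat_mul, mul_div_assoc]

theorem lintegral_sampleLikelihoodRatio_mul {d : ℕ} (n : ℕ) {σ : ℝ} (hσ : 0 < σ)
    (θ δ δ' : EuclideanSpace ℝ (Fin d)) :
    ∫⁻ x, sampleLikelihoodRatio σ θ δ x * sampleLikelihoodRatio σ θ δ' x
        ∂(gaussianSample n σ θ) =
      ENNReal.ofReal (Real.exp (n * inner ℝ δ δ' / σ ^ 2)) := by
  simp_rw [sampleLikelihoodRatio_mul hσ]
  rw [lintegral_const_mul _ (measurable_sampleLikelihoodRatio _ _ _),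
    lintegral_sampleLikelihoodRatio n hσ, mul_one]

/-! ### No spike against a uniform mixture of spikes. -/

theorem eight_mul_mul_le {m D : ℝ≥0} :
    8 * (m * D : ℝ≥0∞) ≤ 4 * (m * m) + 4 * (D * D) + m * m := by
  norm_cast
  rw [← NNReal.coe_le_coe]
  push_cast
  nlinarith [sq_nonneg ((m : ℝ) - D)]

theorem eight_mul_mul_le_add_mul_mul {m D : ℝ≥0} :
    8 * (m * D : ℝ≥0∞) ≤ 4 * (m * D) + 4 * (D * D) + m * m := by
  norm_cast
  rw [← NNReal.coe_le_coe]
  push_cast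
  nlinarith [sq_nonneg ((m : ℝ) - 2 * D)]

/-- Any test `A` has error sum at least 1/4, here scaled by `m`. The sum `D` of the `F j` has mean
`m` and second moment at most `3m²/2`. Integrating a quadratic inequality in `D`, valid on both
sides of the test, gives `8m² ≤ 4mI + 6m² + m²`, with no absolute value or square root. -/
theorem natCast_le_four_mul_lintegral_ite {Y : Type*} [MeasurableSpace Y] {ν : Measure Y}
    [IsProbabilityMeasure ν] {m : ℕ} (hm : 0 < m) {F : Fin m → Y → ℝ≥0∞}
    (hF : ∀ j, Measurable (F j)) (h1 : ∀ j, ∫⁻ x, F j x ∂ν = 1)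
    (h2 : ∀ i j, 2 * ∫⁻ x, F i x * F j x ∂ν ≤ 2 + if i = j then (m : ℝ≥0∞) else 0)
    {A : Set Y} (hA : MeasurableSet A) [DecidablePred (· ∈ A)] :
    (m : ℝ≥0∞) ≤ 4 * ∫⁻ x, (if x ∈ A then (m : ℝ≥0∞) else ∑ j, F j x) ∂ν := by
  have hD : Measurable fun x => ∑ j, F j x := Finset.measurable_fun_sum _ fun j _ => hF j
  have hW : Measurable fun x => if x ∈ A then (m : ℝ≥0∞) else ∑ j, F j x :=
    Measurable.ite hA measurable_const hD
  set I := ∫⁻ x, (if x ∈ A then (m : ℝ≥0∞) else ∑ j, F j x) ∂ν with hI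
  have hD1 : ∫⁻ x, ∑ j, F j x ∂ν = m := by
    rw [lintegral_finsetSum _ fun j _ => hF j]
    simp [h1]
  have hD2 : 2 * ∫⁻ x, (∑ j, F j x) * ∑ j, F j x ∂ν ≤ 3 * (m * m) := by
    have hFF : ∀ i j, Measurable fun x => F i x * F j x := fun i j => (hF i).mul (hF j)
    simp_rw [Finset.sum_mul_sum]
    rw [lintegral_finsetSum _ fun i _ => Finset.measurable_fun_sum _ fun j _ => hFF i j,
      Finset.mul_sum]
    calc ∑ i, 2 * ∫⁻ x, ∑ j, F i x * F j x ∂ν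
        = ∑ i, ∑ j, 2 * ∫⁻ x, F i x * F j x ∂ν := by
          refine Finset.sum_congr rfl fun i _ => ?_
          rw [lintegral_finsetSum _ fun j _ => hFF i j, Finset.mul_sum]
      _ ≤ ∑ i : Fin m, ∑ j : Fin m, (2 + if i = j then (m : ℝ≥0∞) else 0) :=
          Finset.sum_le_sum fun i _ => Finset.sum_le_sum fun j _ => h2 i j
      _ = 3 * (m * m) := by
          simp [Finset.sum_add_distrib]
          ring
  have hpt : ∀ x, 8 * ((m : ℝ≥0∞) * ∑ j, F j x) ≤
      4 * (m * (if x ∈ A then (m : ℝ≥0∞) else ∑ j, F j x)) +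
        4 * ((∑ j, F j x) * ∑ j, F j x) + m * m := by
    intro x
    generalize (∑ j, F j x) = D
    induction D with
    | top => simp
    | coe D =>
      split_ifs
      · exact_mod_cast eight_mul_mul_le (m := m) (D := D)
      · exact_mod_cast eight_mul_mul_le_add_mul_mul (m := m) (D := D)
  have hint := lintegral_mono (μ := ν) hpt
  rw [lintegral_add_left (by fun_prop), lintegral_add_left (by fun_prop),
    lintegral_const_mul _ (by fun_prop), lintegral_const_mul _ (by fun_prop),
    lintegral_const_mul _ (by fun_prop), lintegral_const_mul _ (by fun_prop),
    lintegral_const_mul _ (by fun_prop), hD1, ← hI, lintegral_const, measure_univ, mul_one] at hint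
  generalize (∫⁻ x, (∑ j, F j x) * ∑ j, F j x ∂ν) = S at *
  clear_value I
  induction I with
  | top => simp
  | coe I =>
    induction S with
    | top => simp [ENNReal.mul_top, ENNReal.mul_eq_top] at hD2
    | coe S =>
      have e1 : (8 : ℝ≥0) * (m * m) ≤ 4 * (m * I) + 4 * S + m * m := by exact_mod_cast hint
      have e2 : (2 : ℝ≥0) * S ≤ 3 * (m * m) := by exact_mod_cast hD2
      have e3 : (m : ℝ≥0) ≤ 4 * I := by
        rw [← NNReal.coe_le_coe] at *
        push_cast at *
        have hm' : (0 : ℝ) < m := by exact_mod_cast hm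
        nlinarith
      exact_mod_cast e3

/-- A sparse mixture of `m` spikes cannot be estimated well when its `χ²`-divergence from the
null hypothesis is at most `1 / 2`. -/
theorem spike_mixture_risk_lower_bound {Y : Type*} [MeasurableSpace Y] {ν : Measure Y}
    [IsProbabilityMeasure ν] {m : ℕ} (hm : 0 < m) {F : Fin m → Y → ℝ≥0∞}
    (hF : ∀ j, Measurable (F j)) (h1 : ∀ j, ∫⁻ x, F j x ∂ν = 1)
    (h2 : ∀ i j, 2 * ∫⁻ x, F i x * F j x ∂ν ≤ 2 + if i = j then (m : ℝ≥0∞) else 0)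
    {t : Y → Fin m → ℝ} (ht : ∀ l, Measurable fun x => t x l) {r : ℝ} (hr : 0 ≤ r) :
    m * ENNReal.ofReal (r ^ 2 / 16) ≤
      ∑ j, (∫⁻ x, ENNReal.ofReal (∑ l, t x l ^ 2) ∂ν +
        ∫⁻ x, ENNReal.ofReal (∑ l, (t x l - if l = j then r else 0) ^ 2)
          ∂(ν.withDensity (F j))) := by
  classical
  -- The estimate yields a test at half the spike height: on `A` it loses `r²/4` under no spike; off
  -- `A` every `t x j` is below `r/2`, losing `r²/4` under each spike.
  let A : Set Y := {x | r ^ 2 / 4 ≤ ∑ l, t x l ^ 2}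
  have hA : MeasurableSet A := measurableSet_le measurable_const (by fun_prop)
  have key := natCast_le_four_mul_lintegral_ite hm hF h1 h2 hA
  have hm0 : Measurable fun x => ENNReal.ofReal (∑ l, t x l ^ 2) := by fun_prop
  have hmj : ∀ j, Measurable fun x =>
      ENNReal.ofReal (∑ l, (t x l - if l = j then r else 0) ^ 2) := fun j => by fun_prop
  have hpt : ∀ x, ENNReal.ofReal (r ^ 2 / 4) * (if x ∈ A then (m : ℝ≥0∞) else ∑ j, F j x) ≤
      ∑ j, (ENNReal.ofReal (∑ l, t x l ^ 2) +
        F j x * ENNReal.ofReal (∑ l, (t x l - if l = j then r else 0) ^ 2)) := by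
    intro x
    split_ifs with hx
    · rw [Finset.sum_add_distrib, Finset.sum_const, Finset.card_univ, Fintype.card_fin,
        nsmul_eq_mul, mul_comm]
      exact le_add_right (mul_le_mul_right (ENNReal.ofReal_le_ofReal hx) _)
    · rw [Finset.mul_sum]
      refine Finset.sum_le_sum fun j _ => ?_
      rw [mul_comm]
      refine le_add_left (mul_le_mul_right (ENNReal.ofReal_le_ofReal ?_) _)
      have hx' : ∑ l, t x l ^ 2 < r ^ 2 / 4 := not_le.mp hx
      have h3 : t x j ^ 2 ≤ ∑ l, t x l ^ 2 :=
        Finset.single_le_sum (f := fun l => t x l ^ 2) (fun _ _ => sq_nonneg _)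
          (Finset.mem_univ j)
      have h4 : (t x j - r) ^ 2 ≤ ∑ l, (t x l - if l = j then r else 0) ^ 2 := by
        have := Finset.single_le_sum (f := fun l => (t x l - if l = j then r else 0) ^ 2)
          (fun _ _ => sq_nonneg _) (Finset.mem_univ j)
        simpa using this
      have h5 : |t x j| < r / 2 := abs_lt_of_sq_lt_sq (by nlinarith) (by positivity)
      have h6 := (abs_lt.mp h5).2
      nlinarith
  calc m * ENNReal.ofReal (r ^ 2 / 16)
      ≤ (4 * ∫⁻ x, (if x ∈ A then (m : ℝ≥0∞) else ∑ j, F j x) ∂ν) *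
          ENNReal.ofReal (r ^ 2 / 16) := mul_le_mul_left key _
    _ = ENNReal.ofReal (r ^ 2 / 4) *
          ∫⁻ x, (if x ∈ A then (m : ℝ≥0∞) else ∑ j, F j x) ∂ν := by
        have h4 : ENNReal.ofReal (r ^ 2 / 4) = 4 * ENNReal.ofReal (r ^ 2 / 16) := by
          rw [show r ^ 2 / 4 = 4 * (r ^ 2 / 16) by ring, ENNReal.ofReal_mul (by norm_num),
            ENNReal.ofReal_ofNat]
        rw [h4, mul_right_comm]
    _ = ∫⁻ x, ENNReal.ofReal (r ^ 2 / 4) *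
          (if x ∈ A then (m : ℝ≥0∞) else ∑ j, F j x) ∂ν :=
        (lintegral_const_mul _ (Measurable.ite hA measurable_const
          (Finset.measurable_fun_sum _ fun j _ => hF j))).symm
    _ ≤ _ := lintegral_mono hpt
    _ = _ := by
        rw [lintegral_finsetSum _ fun j _ => by fun_prop]
        refine Finset.sum_congr rfl fun j _ => ?_
        rw [lintegral_add_left hm0, lintegral_withDensity_eq_lintegral_mul _ (hF j) (hmj j)]
        rfl

/-! ### Block prior and reduction to one block. -/

section Spikes

variable {s m d : ℕ}

/-- The vector with entry `r` at the coordinate `e (k, j)`, switched off when the flag is unset. -/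
noncomputable def spike (e : Fin s × Fin m ↪ Fin d) (r : ℝ) (k : Fin s) (ω : Bool × Fin m) :
    EuclideanSpace ℝ (Fin d) :=
  if ω.1 then EuclideanSpace.single (e (k, ω.2)) r else 0

/-- The vector with one optional spike in each block. -/
noncomputable def spikes (e : Fin s × Fin m ↪ Fin d) (r : ℝ) (a : Fin s → Bool × Fin m) :
    EuclideanSpace ℝ (Fin d) :=
  ∑ k, spike e r k (a k)

theorem spike_apply_same (e : Fin s × Fin m ↪ Fin d) (r : ℝ) (k : Fin s) (ω : Bool × Fin m)
    (l : Fin m) : spike e r k ω (e (k, l)) = if ω.1 ∧ l = ω.2 then r else 0 := by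
  unfold spike
  by_cases h : ω.1 <;> simp [h, e.injective.eq_iff]

theorem spike_apply_of_ne (e : Fin s × Fin m ↪ Fin d) (r : ℝ) {k k' : Fin s} (hk : k' ≠ k)
    (ω : Bool × Fin m) (l : Fin m) : spike e r k' ω (e (k, l)) = 0 := by
  unfold spike
  by_cases h : ω.1 <;> simp [h, e.injective.eq_iff, hk.symm]

theorem spikes_apply (e : Fin s × Fin m ↪ Fin d) (r : ℝ) (a : Fin s → Bool × Fin m)
    (k : Fin s) (l : Fin m) :
    spikes e r a (e (k, l)) = if (a k).1 ∧ l = (a k).2 then r else 0 := by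
  unfold spikes
  rw [WithLp.ofLp_sum, Finset.sum_apply, Finset.sum_eq_single k, spike_apply_same]
  · exact fun k' _ hk => spike_apply_of_ne e r hk _ l
  · simp

theorem l0norm_spikes_le (e : Fin s × Fin m ↪ Fin d) (r : ℝ) (a : Fin s → Bool × Fin m) :
    l0norm (spikes e r a) ≤ s := by
  classical
  unfold l0norm hammingNorm
  calc _ ≤ (Finset.univ.image fun k => e (k, (a k).2)).card := by
        refine Finset.card_le_card fun i hi => ?_
        by_contra hni
        refine (Finset.mem_filter.mp hi).2 ?_
        simp only [spikes, WithLp.ofLp_sum, Finset.sum_apply]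
        refine Finset.sum_eq_zero fun k _ => ?_
        have : i ≠ e (k, (a k).2) := fun h =>
          hni (Finset.mem_image.mpr ⟨k, Finset.mem_univ k, h.symm⟩)
        unfold spike
        by_cases h : (a k).1 <;> simp [h, this]
    _ ≤ s := by simpa using Finset.card_image_le (s := Finset.univ) (f := fun k => e (k, (a k).2))

theorem spikes_funSplitAt_symm (e : Fin s × Fin m ↪ Fin d) (r : ℝ) (k : Fin s)
    (ω : Bool × Fin m) (b : {k' // k' ≠ k} → Bool × Fin m) :
    spikes e r ((Equiv.funSplitAt k (Bool × Fin m)).symm (ω, b)) =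
      (∑ k' : {k' // k' ≠ k}, spike e r k' (b k')) + spike e r k ω := by
  unfold spikes
  rw [Fintype.sum_eq_add_sum_subtype_ne _ k, add_comm]
  congr 1
  · refine Finset.sum_congr rfl fun k' _ => ?_
    simp [Equiv.funSplitAt, Equiv.piSplitAt, k'.2]
  · simp [Equiv.funSplitAt, Equiv.piSplitAt]

theorem sum_sum_sub_sq_le (e : Fin s × Fin m ↪ Fin d) (y θ : EuclideanSpace ℝ (Fin d)) :
    ∑ k, ENNReal.ofReal (∑ l, (y (e (k, l)) - θ (e (k, l))) ^ 2) ≤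
      ((nndist y θ ^ 2 : ℝ≥0) : ℝ≥0∞) := by
  have h : ((nndist y θ ^ 2 : ℝ≥0) : ℝ≥0∞) = ENNReal.ofReal (∑ i, (y i - θ i) ^ 2) := by
    rw [← ENNReal.ofReal_coe_nnreal]
    push_cast
    rw [dist_eq_norm, EuclideanSpace.real_norm_sq_eq]
    simp
  rw [h, ← ENNReal.ofReal_sum_of_nonneg fun k _ => Finset.sum_nonneg fun l _ => sq_nonneg _]
  refine ENNReal.ofReal_le_ofReal ?_
  rw [← Fintype.sum_prod_type' (f := fun k l => (y (e (k, l)) - θ (e (k, l))) ^ 2)]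
  rw [← Finset.sum_map Finset.univ e fun i => (y i - θ i) ^ 2]
  exact Finset.sum_le_univ_sum_of_nonneg fun i => sq_nonneg _

/-- The frozen blocks only translate the base point `θ`. An unset flag gives `θ` whatever the
position, so the null counts `m` times and balances the `m` spikes. -/
theorem block_risk_lower_bound (e : Fin s × Fin m ↪ Fin d) (hm : 0 < m) {n : ℕ} {σ r : ℝ}
    (hσ : 0 < σ) (hr : 0 ≤ r) (hrm : 2 * Real.exp (n * r ^ 2 / σ ^ 2) ≤ 2 + m)
    {est : (Fin n → EuclideanSpace ℝ (Fin d)) → EuclideanSpace ℝ (Fin d)} (hest : Measurable est)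
    (k : Fin s) (b : {k' // k' ≠ k} → Bool × Fin m) :
    m * ENNReal.ofReal (r ^ 2 / 16) ≤
      ∑ ω : Bool × Fin m,
        ∫⁻ x, ENNReal.ofReal (∑ l, (est x (e (k, l)) - spikes e r
            ((Equiv.funSplitAt k (Bool × Fin m)).symm (ω, b)) (e (k, l))) ^ 2)
          ∂(gaussianSample n σ
            (spikes e r ((Equiv.funSplitAt k (Bool × Fin m)).symm (ω, b)))) := by
  set θ := ∑ k' : {k' // k' ≠ k}, spike e r k' (b k')
  let δ : Fin m → EuclideanSpace ℝ (Fin d) := fun j => EuclideanSpace.single (e (k, j)) r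
  have hδ : ∀ i j, inner ℝ (δ i) (δ j) = if i = j then r ^ 2 else 0 := by
    intro i j
    by_cases h : i = j
    · simp [δ, h, sq]
    · have h' : e (k, i) ≠ e (k, j) := fun he => h (by simpa using e.injective he)
      simp [δ, h, EuclideanSpace.inner_single_left, h']
  have main := spike_mixture_risk_lower_bound (ν := gaussianSample n σ θ) hm
    (F := fun j => sampleLikelihoodRatio σ θ (δ j))
    (fun j => measurable_sampleLikelihoodRatio σ θ (δ j))
    (fun j => lintegral_sampleLikelihoodRatio n hσ θ (δ j))
    (fun i j => by
      rw [lintegral_sampleLikelihoodRatio_mul n hσ, hδ]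
      split_ifs with h
      · have := ENNReal.ofReal_le_ofReal hrm
        rwa [ENNReal.ofReal_mul (by norm_num), ENNReal.ofReal_add (by norm_num) (by positivity),
          ENNReal.ofReal_natCast, ENNReal.ofReal_ofNat] at this
      · simp)
    (t := fun x l => est x (e (k, l))) (fun l => by fun_prop) hr
  refine main.trans (le_of_eq ?_)
  rw [Fintype.sum_prod_type_right]
  refine Finset.sum_congr rfl fun j _ => ?_
  rw [Fintype.sum_bool, add_comm, ← gaussianSample_add n hσ]
  have ht : spikes e r ((Equiv.funSplitAt k (Bool × Fin m)).symm ((true, j), b)) = θ + δ j := by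
    simp [spikes_funSplitAt_symm, spike, δ, θ]
  have hf : spikes e r ((Equiv.funSplitAt k (Bool × Fin m)).symm ((false, j), b)) = θ := by
    simp [spikes_funSplitAt_symm, spike, θ]
  simp only [spikes_apply]
  rw [ht, hf]
  simp [Equiv.funSplitAt, Equiv.piSplitAt]

theorem spikes_minimax_lower_bound (e : Fin s × Fin m ↪ Fin d) (hm : 0 < m) {n : ℕ} {σ r : ℝ}
    (hσ : 0 < σ) (hr : 0 ≤ r) (hrm : 2 * Real.exp (n * r ^ 2 / σ ^ 2) ≤ 2 + m) :
    ENNReal.ofReal (s * (r ^ 2 / 32)) ≤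
      iidMinimaxRisk n (sparseGaussianFamily s d σ) meanParam (fun t => t ^ 2) nndist := by
  unfold iidMinimaxRisk
  refine le_iInf₂ fun est hest => ?_
  set C := ⨆ P ∈ sparseGaussianFamily s d σ,
    iidRisk n meanParam (fun t => t ^ 2) nndist est P
  let L : Fin s → (Fin s → Bool × Fin m) → ℝ≥0∞ := fun k a =>
    ∫⁻ x, ENNReal.ofReal (∑ l, (est x (e (k, l)) - spikes e r a (e (k, l))) ^ 2)
      ∂(gaussianSample n σ (spikes e r a))
  have hLC : ∀ a, ∑ k, L k a ≤ C := by
    intro a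
    refine le_trans ?_ (le_iSup₂ (f := fun P (_ : P ∈ sparseGaussianFamily s d σ) =>
      iidRisk n meanParam (fun t => t ^ 2) nndist est P) _
      ⟨spikes e r a, l0norm_spikes_le e r a, rfl⟩)
    unfold iidRisk meanParam
    rw [integral_id_multivariateGaussian,
      ← lintegral_finsetSum _ fun k _ => by fun_prop]
    exact lintegral_mono fun x => sum_sum_sub_sq_le e _ _
  let N : ℝ≥0∞ := Fintype.card (Fin s → Bool × Fin m)
  have hN0 : N ≠ 0 := by
    have : Nonempty (Fin m) := ⟨⟨0, hm⟩⟩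
    exact Nat.cast_ne_zero.mpr Fintype.card_ne_zero
  have hNt : N ≠ ⊤ := ENNReal.natCast_ne_top _
  have hL : ∀ k, N * ENNReal.ofReal (r ^ 2 / 16) ≤ 2 * ∑ a, L k a := by
    intro k
    -- The block bound gains a factor `m` from `2m` states; the missing 2 turns `r²/16` into
    -- `r²/32`.
    have hcard : N = 2 * (Fintype.card ({k' // k' ≠ k} → Bool × Fin m) * m) := by
      simp only [N]
      rw [Fintype.card_congr (Equiv.funSplitAt k (Bool × Fin m)), Fintype.card_prod,
        Fintype.card_prod, Fintype.card_bool, Fintype.card_fin]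
      push_cast
      ring
    rw [hcard, mul_assoc, mul_assoc,
      ← Equiv.sum_comp (Equiv.funSplitAt k (Bool × Fin m)).symm (L k),
      Fintype.sum_prod_type_right]
    refine mul_le_mul_right ?_ _
    rw [← nsmul_eq_mul, ← Finset.card_univ, ← Finset.sum_const]
    exact Finset.sum_le_sum fun b _ => block_risk_lower_bound e hm hσ hr hrm hest k b
  have htotal : N * (s * ENNReal.ofReal (r ^ 2 / 16)) ≤ N * (2 * C) := by
    calc N * (s * ENNReal.ofReal (r ^ 2 / 16))
        = ∑ _k : Fin s, N * ENNReal.ofReal (r ^ 2 / 16) := by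
          simp
          ring
      _ ≤ ∑ k, 2 * ∑ a, L k a := Finset.sum_le_sum fun k _ => hL k
      _ = 2 * ∑ a, ∑ k, L k a := by rw [← Finset.mul_sum, Finset.sum_comm]
      _ ≤ 2 * ∑ _a : Fin s → Bool × Fin m, C :=
          mul_le_mul_right (Finset.sum_le_sum fun a _ => hLC a) _
      _ = N * (2 * C) := by
          rw [Finset.sum_const, Finset.card_univ, nsmul_eq_mul]
          ring
  rw [ENNReal.mul_le_mul_iff_right hN0 hNt] at htotal
  rw [← ENNReal.mul_le_mul_iff_right (a := 2) (by norm_num) (by norm_num)]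
  refine le_trans (le_of_eq ?_) htotal
  rw [← ENNReal.ofReal_natCast, ← ENNReal.ofReal_mul (by positivity),
    ← ENNReal.ofReal_ofNat, ← ENNReal.ofReal_mul (by norm_num)]
  congr 1
  ring

end Spikes

/-! ### Choice of block size and spike height. -/

theorem corollary3 :
    ∃ c : ℝ, 0 < c ∧ ∀ (n d s : ℕ) (σ : ℝ), 0 < n → 0 < d → 0 < s → 0 < σ →
      ENNReal.ofReal (c * (σ ^ 2 * s * Real.log (d / s) / n)) ≤
        iidMinimaxRisk n (sparseGaussianFamily s d σ) meanParam (fun t => t ^ 2) nndist := by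
  refine ⟨1 / 64, by norm_num, fun n d s σ hn hd hs hσ => ?_⟩
  have hn' : (0 : ℝ) < n := by exact_mod_cast hn
  have hd' : (0 : ℝ) < d := by exact_mod_cast hd
  have hs' : (0 : ℝ) < s := by exact_mod_cast hs
  -- For `d < s` the logarithm is nonpositive and the bound is trivial.
  rcases lt_or_ge d s with hds | hds
  · have hlog : Real.log (d / s) ≤ 0 :=
      Real.log_nonpos (by positivity) ((div_le_one hs').mpr (by exact_mod_cast hds.le))
    rw [ENNReal.ofReal_of_nonpos]
    · exact zero_le
    · have : σ ^ 2 * s * Real.log (d / s) / n ≤ 0 :=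
        div_nonpos_of_nonpos_of_nonneg (mul_nonpos_of_nonneg_of_nonpos (by positivity) hlog) hn'.le
      linarith
  set m := d / s
  have hm0 : 0 < m := Nat.div_pos hds hs
  have hsm : s * m ≤ d := Nat.mul_div_le d s
  let e : Fin s × Fin m ↪ Fin d := finProdFinEquiv.toEmbedding.trans (Fin.castLEEmb hsm)
  have hlogm : 0 ≤ Real.log (m + 1) := Real.log_nonneg (by linarith [Nat.cast_nonneg (α := ℝ) m])
  set r := Real.sqrt (σ ^ 2 * Real.log (m + 1) / (2 * n)) with hr
  have hr2 : r ^ 2 = σ ^ 2 * Real.log (m + 1) / (2 * n) := Real.sq_sqrt (by positivity)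
  have hexp : 2 * Real.exp (n * r ^ 2 / σ ^ 2) ≤ 2 + m := by
    have h1 : n * r ^ 2 / σ ^ 2 = Real.log (m + 1) / 2 := by
      rw [hr2]
      field_simp
    have h2 : Real.exp (Real.log (m + 1) / 2) ^ 2 = m + 1 := by
      rw [← Real.exp_nat_mul]
      push_cast
      rw [mul_div_cancel₀ _ two_ne_zero, Real.exp_log (by positivity)]
    rw [h1]
    -- This is `2√(m+1) ≤ (m+1) + 1`.
    nlinarith [sq_nonneg (Real.exp (Real.log (m + 1) / 2) - 1)]
  refine le_trans (ENNReal.ofReal_le_ofReal ?_)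
    (spikes_minimax_lower_bound e hm0 hσ (Real.sqrt_nonneg _) hexp)
  -- The `+ 1` absorbs the rounding in `m` and keeps the logarithm positive at `m = 1`.
  have hlog : Real.log (d / s) ≤ Real.log (m + 1) := by
    refine Real.log_le_log (by positivity) ?_
    rw [div_le_iff₀ hs']
    exact_mod_cast (Nat.lt_mul_of_div_lt (Nat.lt_succ_self (d / s)) hs).le
  rw [← hr, hr2]
  calc 1 / 64 * (σ ^ 2 * s * Real.log (d / s) / n)
      ≤ 1 / 64 * (σ ^ 2 * s * Real.log (m + 1) / n) := by gcongr
    _ = s * (σ ^ 2 * Real.log (m + 1) / (2 * n) / 32) := by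
        ring
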